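/- Let $K\subset\mathbb{C}$ be bounded and convex, with diameter $s\ge 0$, let $n$ and $k$ be positive integers with $k\le n$, and let $\varepsilon>0$ be real. Zeros, poles and critical points of a rational function $f\in\mathbb{C}(z)$, $f\neq 0$, are taken in $\mathbb{C}$ (not at $\infty$) and counted with multiplicity; the critical points of $f$ are the zeros of the rational function $f'$. Say that $K$ satisfies $\mathcal{RAGL}(n,k,\varepsilon)$ if every rational function $f$ whose number of zeros plus number of poles is exactly $n$, and which has at least $k$ zeros in $K$, has at least $k-1$ critical points in the $\varepsilon$-neighbourhood $K_\varepsilon=\{z\in\mathbb{C}: |z-w|<\varepsilon \text{ for some } w\in K\}$. If $$\frac{16(s+\varepsilon)^2}{\varepsilon^2}<\frac{k}{(n-k)^2},$$ then $K$ satisfies $\mathcal{RAGL}(n,k,\varepsilon)$. Moreover, if $K$ is a disk (open or closed), then the condition $$\frac{8(s+\varepsilon)}{\varepsilon}<\frac{k}{(n-k)^2}$$ suffices for $K$ to satisfy $\mathcal{RAGL}(n,k,\varepsilon)$. When $k=n$, the right-hand side of both inequalities is read as $+\infty$, so that both conditions hold. -/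

import Mathlib

open Polynomial

noncomputable section

namespace RationalGaussLucas

/-- The number of zeros in `G`, counted with multiplicity, of a rational function `f`,
i.e. the roots of the numerator of `f` in lowest terms. (By convention `0` for `f = 0`.) -/
def zeroCount (f : RatFunc ℂ) (G : Set ℂ) : ℕ :=
  open Classical in f.num.roots.countP (fun z => z ∈ G)

/-- The number of (finite) poles in `G`, counted with multiplicity, of a rational function `f`,
i.e. the roots of the denominator of `f` in lowest terms. -/
def poleCount (f : RatFunc ℂ) (G : Set ℂ) : ℕ :=
  open Classical in f.denom.roots.countP (fun z => z ∈ G)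

/-- The derivative `f' = (p' q - p q') / q ^ 2` of a rational function `f = p / q`. -/
def ratDeriv (f : RatFunc ℂ) : RatFunc ℂ :=
  algebraMap ℂ[X] (RatFunc ℂ)
      (derivative f.num * f.denom - f.num * derivative f.denom) /
    algebraMap ℂ[X] (RatFunc ℂ) (f.denom ^ 2)

/-- The number of critical points of `f` in `G`: the zeros of `f'`, counted with multiplicity.
The derivative is taken in lowest terms, so that no pole of `f` is counted. -/
def critCount (f : RatFunc ℂ) (G : Set ℂ) : ℕ :=
  zeroCount (ratDeriv f) G

/-- The rational approximate Gauss-Lucas property of `K`: every rational function with `n` zeros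
and poles in total, at least `k` of its zeros in `K`, has at least `k - 1` critical points in the
`ε`-neighbourhood of `K`. -/
def RAGL (K : Set ℂ) (n k : ℕ) (ε : ℝ) : Prop :=
  ∀ f : RatFunc ℂ, f ≠ 0 → zeroCount f Set.univ + poleCount f Set.univ = n →
    k ≤ zeroCount f K → k - 1 ≤ critCount f (Metric.thickening ε K)

/-- `K` is a disk, open or closed (a single point is a closed disk of radius `0`). -/
def IsDisk (K : Set ℂ) : Prop :=
  ∃ (c : ℂ) (r : ℝ), (0 < r ∧ K = Metric.ball c r) ∨ (0 ≤ r ∧ K = Metric.closedBall c r)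

end RationalGaussLucas

end

namespace RationalGaussLucas

/-! Write f = c·gh/q, where g carries the zeros in K, h the other zeros and q the poles. With m = n
- k, h and q together have at most m roots. Up to the factor c, the numerator of f' is g'hq + (h'gq
- q'gh). Divided by ghq, the first term is the Cauchy sum over the zeros of g, and the second a
difference of Cauchy sums over the at most m remaining points.

By pigeonhole some δ in [ε/2, ε) keeps these points ε/(8m) away from the boundary of the
δ-neighbourhood (`exists_level_far`), so there the second sum is at most 8m²/ε. Convexity aligns the
kernels of the points of K, so the first sum is at least kL (`exists_re_cauchy_ge`, sharper for
disks in `IsDisk.exists_re_cauchy_ge`). The hypothesis gives 8m²/ε < kL, and Rouché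
(`countP_roots_wronskian`, resting on `countP_roots_add_eq`) then counts the zeros of the numerator
like those of g'hq. Gauss-Lucas puts all zeros of g', at least k - 1, in K; the zeros of q
compensate for those lost by cancellation at the poles (`le_critCount`). -/

/-! ### Homotopy invariance of root counts -/

theorem exists_fin_map_eq (s : Multiset ℂ) (d : ℕ) (hd : s.card = d) :
    ∃ r : Fin d → ℂ, (Finset.univ : Finset (Fin d)).val.map r = s := by
  subst hd
  obtain ⟨l, rfl⟩ := Quot.exists_rep s
  exact ⟨fun i => l.get i, by
    rw [Fin.univ_val_map]
    exact congrArg _ (List.ofFn_get l)⟩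

/-- A root of `p` is bounded by one plus the sum of the normalised coefficients. -/
theorem norm_root_le {p : ℂ[X]} (hp : p ≠ 0) {z : ℂ} (hz : p.IsRoot z) :
    ‖z‖ ≤ ∑ i ∈ Finset.range p.natDegree, ‖p.coeff i‖ / ‖p.leadingCoeff‖ + 1 := by
  have h := (IsRoot.norm_lt_cauchyBound hp hz).le
  have h2 : (cauchyBound p : ℝ) ≤
      ∑ i ∈ Finset.range p.natDegree, ‖p.coeff i‖ / ‖p.leadingCoeff‖ + 1 := by
    rw [← Finset.sum_div, cauchyBound]
    push_cast
    gcongr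
    have : Finset.sup (Finset.range p.natDegree) (‖p.coeff ·‖₊) ≤
        ∑ i ∈ Finset.range p.natDegree, ‖p.coeff i‖₊ :=
      Finset.sup_le fun i hi =>
        Finset.single_le_sum (f := fun i => ‖p.coeff i‖₊) (fun _ _ => zero_le) hi
    simpa using NNReal.coe_le_coe.2 this
  exact le_trans (by exact_mod_cast h) h2

open Classical in
/-- Homotopy invariance of the number of roots in an open set, along a segment of polynomials of
constant degree without roots on the frontier. -/
theorem countP_roots_add_eq {F G : ℂ[X]} {d : ℕ} (hF : F.natDegree ≤ d) (hG : G.natDegree ≤ d)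
    (hlead : ∀ t ∈ Set.Icc (0 : ℝ) 1, F.coeff d + t * G.coeff d ≠ 0)
    {U : Set ℂ} (hU : IsOpen U)
    (hfr : ∀ t ∈ Set.Icc (0 : ℝ) 1, ∀ z ∈ frontier U, F.eval z + t * G.eval z ≠ 0) :
    (F + G).roots.countP (· ∈ U) = F.roots.countP (· ∈ U) := by
  set p : unitInterval → ℂ[X] := fun t => F + C ((t : ℝ) : ℂ) * G with hp
  have hcoeff : ∀ t i, (p t).coeff i = F.coeff i + (t : ℝ) * G.coeff i := fun t i => by simp [hp]
  have heval : ∀ t z, (p t).eval z = F.eval z + (t : ℝ) * G.eval z := fun t z => by simp [hp]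
  have hld : ∀ t, (p t).coeff d ≠ 0 := fun t => by rw [hcoeff]; exact hlead t t.2
  have hdeg : ∀ t, (p t).natDegree = d := fun t =>
    natDegree_eq_of_le_of_coeff_ne_zero
      (natDegree_add_le_of_degree_le hF ((natDegree_C_mul_le _ _).trans hG)) (hld t)
  have hne : ∀ t, p t ≠ 0 := fun t h => hld t (by simp [h])
  have hlc : ∀ t, (p t).leadingCoeff = (p t).coeff d := fun t => by rw [leadingCoeff, hdeg]
  have hcc : ∀ i, Continuous fun t => (p t).coeff i := fun i => by
    simp only [hcoeff]; fun_prop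
  obtain ⟨R, hR⟩ : ∃ R : ℝ, ∀ t z, (p t).IsRoot z → ‖z‖ ≤ R := by
    have hcont : Continuous fun t =>
        ∑ i ∈ Finset.range d, ‖(p t).coeff i‖ / ‖(p t).coeff d‖ + 1 :=
      (continuous_finsetSum _ fun i _ => (hcc i).norm.div (hcc d).norm
        fun t => norm_ne_zero_iff.2 (hld t)).add continuous_const
    obtain ⟨R, hR⟩ := (isCompact_range hcont).bddAbove
    refine ⟨R, fun t z hz => (norm_root_le (hne t) hz).trans ?_⟩
    rw [hdeg, hlc]
    exact hR ⟨t, rfl⟩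
  -- Pairs of a time and an enumeration of its roots. Using `closure U` and `Uᶜ` makes both
  -- membership conditions closed, and they exclude each other because no root meets the frontier.
  -- Compactness makes the projections to time closed, so the count is a continuous map from a
  -- connected space to ℕ.
  set T : Finset (Fin d) → Set (unitInterval × (Fin d → ℂ)) := fun I =>
    {x | (∀ z, (p x.1).eval z = (p x.1).coeff d * ∏ i, (z - x.2 i)) ∧
      (∀ i ∈ I, x.2 i ∈ closure U) ∧ (∀ i ∉ I, x.2 i ∈ Uᶜ) ∧ ∀ i, ‖x.2 i‖ ≤ R} with hT
  have hTclosed : ∀ I, IsClosed (T I) := by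
    intro I
    have h1 : IsClosed {x : unitInterval × (Fin d → ℂ) |
        ∀ z, (p x.1).eval z = (p x.1).coeff d * ∏ i, (z - x.2 i)} := by
      simp only [Set.ofPred_forall, heval, hcoeff]
      exact isClosed_iInter fun z => isClosed_eq (by fun_prop) (by fun_prop)
    have h2 : IsClosed {x : unitInterval × (Fin d → ℂ) | ∀ i ∈ I, x.2 i ∈ closure U} := by
      simp only [Set.ofPred_forall]
      exact isClosed_iInter fun i => isClosed_iInter fun _ =>
        isClosed_closure.preimage (by fun_prop)
    have h3 : IsClosed {x : unitInterval × (Fin d → ℂ) | ∀ i ∉ I, x.2 i ∈ Uᶜ} := by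
      simp only [Set.ofPred_forall]
      exact isClosed_iInter fun i => isClosed_iInter fun _ =>
        hU.isClosed_compl.preimage (f := fun x : unitInterval × (Fin d → ℂ) => x.2 i)
          (by fun_prop)
    have h4 : IsClosed {x : unitInterval × (Fin d → ℂ) | ∀ i, ‖x.2 i‖ ≤ R} := by
      simp only [Set.ofPred_forall]
      exact isClosed_iInter fun i => isClosed_le (by fun_prop) continuous_const
    exact h1.inter (h2.inter (h3.inter h4))
  have hTcompact : ∀ I, IsCompact (T I) := fun I =>
    (isCompact_univ.prod (isCompact_univ_pi fun _ : Fin d =>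
      isCompact_closedBall (0 : ℂ) R)).of_isClosed_subset (hTclosed I) fun x hx => by
        simpa using hx.2.2.2
  set c : unitInterval → ℕ := fun t => (p t).roots.countP (· ∈ U) with hc
  have hcT : ∀ m, c ⁻¹' {m} =
      ⋃ I ∈ (Finset.univ : Finset (Finset (Fin d))).filter (·.card = m), Prod.fst '' T I := by
    intro m
    ext t
    simp only [Set.mem_preimage, Set.mem_singleton_iff, Set.mem_iUnion, Finset.mem_filter,
      Finset.mem_univ, true_and, Set.mem_image, Prod.exists, exists_and_right, exists_eq_right,
      exists_prop]
    have hsplit : (p t).roots.card = d := by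
      rw [← hdeg t]; exact ((IsAlgClosed.splits (p t)).natDegree_eq_card_roots).symm
    constructor
    · intro hm
      obtain ⟨r, hr⟩ := exists_fin_map_eq _ d hsplit
      have hroot : ∀ i, (p t).IsRoot (r i) := fun i => by
        rw [← mem_roots (hne t), ← hr]
        exact Multiset.mem_map_of_mem _ (Finset.mem_univ i)
      refine ⟨Finset.univ.filter (fun i => r i ∈ U), ?_, r, ?_, ?_, ?_, fun i => hR t _ (hroot i)⟩
      · rw [← hm, hc]
        simp only
        rw [← hr, Multiset.countP_map]
        rfl
      · intro z
        conv_lhs => rw [(IsAlgClosed.splits (p t)).eq_prod_roots, ← hr]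
        simp only [eval_mul, eval_C, hlc, Multiset.map_map, eval_multiset_prod]
        simp [Finset.prod]
      · intro i hi
        exact subset_closure (Finset.mem_filter.1 hi).2
      · intro i hi
        simpa using hi
    · rintro ⟨I, hI, r, h1, h2, h3, -⟩
      have hpt : p t = C ((p t).coeff d) * ∏ i, (X - C (r i)) :=
        Polynomial.funext fun z => by rw [h1 z]; simp [eval_prod]
      have hroots : (p t).roots = (Finset.univ : Finset (Fin d)).val.map r := by
        rw [hpt, roots_C_mul _ (hld t)]
        have := roots_multiset_prod_X_sub_C ((Finset.univ : Finset (Fin d)).val.map r)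
        rw [Multiset.map_map] at this
        exact this
      rw [← hI, hc]
      simp only
      rw [hroots, Multiset.countP_map]
      change (Finset.univ.filter fun i => r i ∈ U).card = I.card
      congr 1
      ext i
      simp only [Finset.mem_filter, Finset.mem_univ, true_and]
      refine ⟨fun hi => by_contra fun h => h3 i h hi, fun hi => by_contra fun h => ?_⟩
      have hfi : r i ∈ frontier U := by
        rw [hU.frontier_eq]; exact ⟨h2 i hi, h⟩
      refine hfr t t.2 _ hfi ?_
      rw [← heval, h1]
      rw [Finset.prod_eq_zero (Finset.mem_univ i) (sub_self _), mul_zero]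
  have hclosed : ∀ m, IsClosed (c ⁻¹' {m}) := fun m => by
    rw [hcT]
    exact Set.Finite.isClosed_biUnion (Finset.finite_toSet _) fun I _ =>
      ((hTcompact I).image continuous_fst).isClosed
  have hcont : Continuous c := by
    rw [continuous_iff_isClosed]
    intro s _
    have : c ⁻¹' s = ⋃ m ∈ (Finset.range (d + 1)).filter (· ∈ s), c ⁻¹' {m} := by
      ext t
      have : c t < d + 1 := Nat.lt_succ_of_le
        ((Multiset.countP_le_card _ _).trans ((card_roots' _).trans (hdeg t).le))
      simpa using fun _ => Nat.lt_succ_iff.1 this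
    rw [this]
    exact Set.Finite.isClosed_biUnion (Finset.finite_toSet _) fun m _ => hclosed m
  have := PreconnectedSpace.constant (inferInstance : PreconnectedSpace unitInterval) hcont
    (x := 1) (y := 0)
  simpa [hc, hp] using this

/-! ### Lower bounds for Cauchy kernels -/

theorem re_mul_one_div (u v : ℂ) : (u * (1 / v)).re = inner ℝ v u / ‖v‖ ^ 2 := by
  rw [Complex.inner, ← Complex.normSq_eq_norm_sq, one_div, Complex.inv_def]
  simp [Complex.mul_re, Complex.mul_im]
  ring

/-- Outside a bounded convex set, a supporting direction bounds all Cauchy kernels from below. -/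
theorem exists_re_cauchy_ge {K : Set ℂ} (hKb : Bornology.IsBounded K) (hKc : Convex ℝ K)
    (hK : K.Nonempty) {z : ℂ} {δ : ℝ} (hδ : 0 < δ) (hz : Metric.infDist z K = δ) :
    ∃ u : ℂ, ‖u‖ ≤ 1 ∧ ∀ a ∈ K, δ / (Metric.diam K + δ) ^ 2 ≤ (u * (1 / (z - a))).re := by
  obtain ⟨w, hw, hzw⟩ := Metric.exists_mem_closure_infDist_eq_dist hK z
  have hn : ‖z - w‖ = δ := by rw [← dist_eq_norm, ← hzw, hz]
  -- Variational inequality for the nearest point w: K lies behind the supporting line at w.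
  have hin : ∀ a ∈ K, inner ℝ (z - w) (a - w) ≤ 0 := by
    intro a ha
    refine (norm_eq_iInf_iff_real_inner_le_zero hKc.closure hw).1 ?_ a (subset_closure ha)
    rw [← dist_eq_norm, ← hzw, ← Metric.infDist_closure, Metric.infDist_eq_iInf]
    simp only [dist_eq_norm]
  refine ⟨((δ⁻¹ : ℝ) : ℂ) * (z - w), ?_, fun a ha => ?_⟩
  · rw [norm_mul, hn, Complex.norm_real, Real.norm_of_nonneg (by positivity),
      inv_mul_cancel₀ hδ.ne']
  · have h1 : δ ≤ inner ℝ (z - a) (((δ⁻¹ : ℝ) : ℂ) * (z - w)) := by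
      rw [← Complex.real_smul, inner_smul_right, ← sub_sub_sub_cancel_right z a w, inner_sub_left,
        real_inner_self_eq_norm_sq, hn, real_inner_comm]
      have : δ = δ⁻¹ * δ ^ 2 := by field_simp
      have h2 : 0 ≤ δ⁻¹ * -inner ℝ (z - w) (a - w) :=
        mul_nonneg (by positivity) (by linarith [hin a ha])
      nlinarith
    have h2 : ‖z - a‖ ≤ Metric.diam K + δ := by
      have := dist_triangle z w a
      rw [dist_eq_norm z a, dist_eq_norm z w, hn] at this
      have h3 : dist w a ≤ Metric.diam K := by
        rw [← Metric.diam_closure]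
        exact Metric.dist_le_diam_of_mem hKb.closure hw (subset_closure ha)
      linarith
    have h3 : 0 < ‖z - a‖ := by
      rw [← dist_eq_norm]
      exact (hz ▸ hδ).trans_le (Metric.infDist_le_dist_of_mem ha)
    rw [re_mul_one_div]
    exact div_le_div₀ (hδ.le.trans h1) h1 (by positivity) (by gcongr)

/-- For a disk the kernel bound improves, since inversion maps disks to disks. -/
theorem IsDisk.exists_re_cauchy_ge {K : Set ℂ} (hK : IsDisk K) {z : ℂ} {δ : ℝ} (hδ : 0 < δ)
    (hz : Metric.infDist z K = δ) :
    ∃ u : ℂ, ‖u‖ ≤ 1 ∧ ∀ a ∈ K, 1 / (Metric.diam K + δ) ≤ (u * (1 / (z - a))).re := by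
  obtain ⟨c, r, hr, hdiam, hKsub, hne, hcl⟩ : ∃ (c : ℂ) (r : ℝ), 0 ≤ r ∧
      Metric.diam K = 2 * r ∧ K ⊆ Metric.closedBall c r ∧ K.Nonempty ∧
      closure K = Metric.closedBall c r := by
    obtain ⟨c, r, ⟨hr, rfl⟩ | ⟨hr, rfl⟩⟩ := hK
    · exact ⟨c, r, hr.le, Metric.diam_ball_eq c hr.le, Metric.ball_subset_closedBall,
        Metric.nonempty_ball.2 hr, closure_ball c hr.ne'⟩
    · exact ⟨c, r, hr, Metric.diam_closedBall_eq c hr, subset_rfl,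
        Metric.nonempty_closedBall.2 hr, Metric.isClosed_closedBall.closure_eq⟩
  have hR : r < ‖z - c‖ := by
    have : z ∉ closure K := (Metric.infDist_pos_iff_notMem_closure hne).2 (hz ▸ hδ)
    rw [hcl, Metric.mem_closedBall, not_le, dist_eq_norm] at this
    exact this
  have hRle : ‖z - c‖ ≤ r + δ := by
    have : ‖z - c‖ - r ≤ Metric.infDist z K := (Metric.le_infDist hne).2 fun y hy => by
      have h1 := dist_triangle z y c
      have h2 := Metric.mem_closedBall.1 (hKsub hy)
      rw [dist_eq_norm z c] at h1
      linarith
    linarith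
  have hR0 : 0 < ‖z - c‖ := hr.trans_lt hR
  refine ⟨((‖z - c‖⁻¹ : ℝ) : ℂ) * (z - c), ?_, fun a ha => ?_⟩
  · rw [norm_mul, Complex.norm_real, Real.norm_of_nonneg (by positivity),
      inv_mul_cancel₀ hR0.ne']
  · have hb : ‖a - c‖ ≤ r := by
      rw [← dist_eq_norm]; exact Metric.mem_closedBall.1 (hKsub ha)
    have h3 : 0 < ‖z - a‖ := by
      rw [← dist_eq_norm]
      exact (hz ▸ hδ).trans_le (Metric.infDist_le_dist_of_mem ha)
    set R := ‖z - c‖ with hRdef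
    set x : ℝ := inner ℝ (z - c) (a - c) with hx
    have hxlow : -(R * r) ≤ x := by
      have := (abs_le.1 (abs_real_inner_le_norm (z - c) (a - c))).1
      nlinarith
    have hsq : ‖z - a‖ ^ 2 = R ^ 2 - 2 * x + ‖a - c‖ ^ 2 := by
      rw [← sub_sub_sub_cancel_right z a c, norm_sub_sq_real]
    have hinn : inner ℝ (z - a) (((R⁻¹ : ℝ) : ℂ) * (z - c)) = R⁻¹ * (R ^ 2 - x) := by
      rw [← Complex.real_smul, inner_smul_right, ← sub_sub_sub_cancel_right z a c, inner_sub_left,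
        real_inner_self_eq_norm_sq, real_inner_comm]
    rw [re_mul_one_div, hinn, div_le_div_iff₀ (by rw [hdiam]; linarith) (by positivity), one_mul]
    have hb2 : ‖a - c‖ ^ 2 ≤ r ^ 2 := by gcongr
    have hprod : 0 ≤ (R - r) * (x + R * r) := mul_nonneg (by linarith) (by linarith)
    -- The difference of the two sides is (R - r)(x + Rr) + R(r² - ‖a - c‖²).
    have hkey : R * ‖z - a‖ ^ 2 ≤ (R ^ 2 - x) * (r + R) := by
      rw [hsq]; nlinarith
    have hpos : 0 ≤ R ^ 2 - x := by
      have : 0 ≤ (R ^ 2 - x) * (r + R) := le_trans (by positivity) hkey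
      exact nonneg_of_mul_nonneg_left this (by linarith)
    calc ‖z - a‖ ^ 2 = R⁻¹ * (R * ‖z - a‖ ^ 2) := by field_simp
      _ ≤ R⁻¹ * ((R ^ 2 - x) * (r + R)) := by gcongr
      _ ≤ R⁻¹ * ((R ^ 2 - x) * (Metric.diam K + δ)) := by
        have : r + R ≤ Metric.diam K + δ := by linarith
        gcongr
      _ = R⁻¹ * (R ^ 2 - x) * (Metric.diam K + δ) := by ring

/-! ### Kernel sums and the choice of level -/

theorem norm_sum_map_le {s : Multiset ℂ} {f : ℂ → ℂ} {c : ℝ} (h : ∀ b ∈ s, ‖f b‖ ≤ c) :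
    ‖(s.map f).sum‖ ≤ s.card * c := by
  refine (norm_multiset_sum_le _).trans ((Multiset.sum_le_card_nsmul _ c fun x hx => ?_).trans ?_)
  · simp only [Multiset.map_map, Multiset.mem_map, Function.comp] at hx
    obtain ⟨b, hb, rfl⟩ := hx
    exact h b hb
  · simp

/-- A common direction `u` rules out cancellation between the summands. -/
theorem le_norm_sum_map {s : Multiset ℂ} {f : ℂ → ℂ} {u : ℂ} (hu : ‖u‖ ≤ 1) {c : ℝ}
    (h : ∀ a ∈ s, c ≤ (u * f a).re) : s.card * c ≤ ‖(s.map f).sum‖ := by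
  have h1 : s.card * c ≤ (u * (s.map f).sum).re := by
    rw [← Multiset.sum_map_mul_left]
    induction s using Multiset.induction with
    | empty => simp
    | cons a s ih =>
      have := ih fun b hb => h b (Multiset.mem_cons_of_mem hb)
      have := h a (Multiset.mem_cons_self a s)
      simp only [Multiset.map_cons, Multiset.sum_cons, Multiset.card_cons, Complex.add_re]
      push_cast
      linarith
  calc _ ≤ _ := h1
    _ ≤ ‖u * (s.map f).sum‖ := Complex.re_le_norm _
    _ ≤ 1 * ‖(s.map f).sum‖ := by rw [norm_mul]; gcongr
    _ = _ := one_mul _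

/-- Pigeonhole: some level in `[ε / 2, ε)` stays away from `m` given numbers. -/
theorem exists_level_far {ε : ℝ} (hε : 0 < ε) {m : ℕ} (D : Finset ℝ) (hD : D.card ≤ m) :
    ∃ δ, ε / 2 ≤ δ ∧ δ < ε ∧ ∀ d ∈ D, ε / (8 * m) ≤ |δ - d| := by
  rcases Nat.eq_zero_or_pos m with rfl | hm
  · obtain rfl : D = ∅ := Finset.card_eq_zero.1 (Nat.le_zero.1 hD)
    exact ⟨ε / 2, le_rfl, half_lt_self hε, by simp⟩
  have hm' : (0 : ℝ) < m := by exact_mod_cast hm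
  set r := ε / (8 * m) with hr
  have hr0 : 0 < r := by positivity
  have hrm : 8 * (m * r) = ε := by rw [hr]; field_simp
  by_contra! H
  -- The m + 1 candidates have spacing 2r and end at 3ε/4; one point of `D` cannot be within r of
  -- two of them.
  have H' : ∀ i ∈ Finset.range (m + 1), ∃ d ∈ D, |ε / 2 + i * (2 * r) - d| < r := by
    intro i hi
    have hi' : (i : ℝ) ≤ m := by exact_mod_cast Nat.lt_succ_iff.1 (Finset.mem_range.1 hi)
    refine H _ (by have : 0 ≤ (i : ℝ) * (2 * r) := by positivity
                   linarith) ?_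
    nlinarith
  choose! g hgD hg using H'
  obtain ⟨i, hi, j, hj, hij, hgij⟩ := Finset.exists_ne_map_eq_of_card_lt_of_maps_to
    (by rw [Finset.card_range]; omega) hgD
  have hi2 := abs_lt.1 (hg i hi)
  have hj2 := abs_lt.1 (hg j hj)
  rw [← hgij] at hj2
  rcases lt_or_gt_of_ne hij with h | h
  · have : (i : ℝ) + 1 ≤ j := by exact_mod_cast h
    nlinarith
  · have : (j : ℝ) + 1 ≤ i := by exact_mod_cast h
    nlinarith

/-! ### Rouché for the numerator of the derivative -/

theorem natDegree_derivative_mul_le (p q : ℂ[X]) :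
    (derivative p * q).natDegree ≤ p.natDegree + q.natDegree - 1 := by
  rcases Nat.eq_zero_or_pos p.natDegree with h | h
  · rw [natDegree_eq_zero.1 h |>.choose_spec.symm]; simp
  · refine natDegree_mul_le.trans ?_
    have := natDegree_derivative_le p
    omega

theorem coeff_derivative_mul {p q : ℂ[X]} (hp : p.Monic) (hq : q.Monic) :
    (derivative p * q).coeff (p.natDegree + q.natDegree - 1) = p.natDegree := by
  rcases Nat.eq_zero_or_pos p.natDegree with h | h
  · rw [eq_one_of_monic_natDegree_zero hp h]; simp
  · rw [Nat.sub_add_comm h, coeff_mul_add_eq_of_natDegree_le (natDegree_derivative_le p) le_rfl,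
      hq.coeff_natDegree, mul_one, coeff_derivative, Nat.sub_add_cancel h, hp.coeff_natDegree,
      one_mul]
    exact_mod_cast congrArg Nat.cast (Nat.sub_add_cancel h)

/-- The monic polynomial with prescribed roots. -/
noncomputable def ofRoots (s : Multiset ℂ) : ℂ[X] := (s.map fun a => X - C a).prod

theorem ofRoots_monic (s : Multiset ℂ) : (ofRoots s).Monic := monic_multisetProd_X_sub_C s

theorem roots_ofRoots (s : Multiset ℂ) : (ofRoots s).roots = s := roots_multiset_prod_X_sub_C s

theorem natDegree_ofRoots (s : Multiset ℂ) : (ofRoots s).natDegree = s.card :=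
  natDegree_multiset_prod_X_sub_C_eq_card s

theorem eval_ofRoots_ne_zero {s : Multiset ℂ} {z : ℂ} (hz : z ∉ s) : (ofRoots s).eval z ≠ 0 := by
  intro h
  refine hz ?_
  rw [← roots_ofRoots s]
  exact (mem_roots (ofRoots_monic s).ne_zero).2 h

theorem eval_derivative_ofRoots {s : Multiset ℂ} {z : ℂ} (hz : z ∉ s) :
    (derivative (ofRoots s)).eval z =
      (ofRoots s).eval z * (s.map fun a => 1 / (z - a)).sum := by
  rw [(IsAlgClosed.splits (ofRoots s)).eval_derivative_eq_eval_mul_sum (eval_ofRoots_ne_zero hz),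
    roots_ofRoots]

/-- This is the classical Gauss-Lucas theorem. -/
theorem mem_of_mem_roots_derivative {A : Multiset ℂ} {K : Set ℂ} (hK : Convex ℝ K)
    (hA : ∀ a ∈ A, a ∈ K) {z : ℂ} (hz : z ∈ (derivative (ofRoots A)).roots) : z ∈ K := by
  have h0 : derivative (ofRoots A) ≠ 0 := fun h => by simp [h] at hz
  have hdeg : 0 < (ofRoots A).degree := by
    rw [← natDegree_pos_iff_degree_pos]
    refine Nat.pos_of_ne_zero fun h => h0 ?_
    rw [eq_one_of_monic_natDegree_zero (ofRoots_monic A) h, derivative_one]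
  refine convexHull_min ?_ hK (rootSet_derivative_subset_convexHull_rootSet hdeg
    ((mem_rootSet_of_ne h0).2 (by simpa using (mem_roots h0).1 hz)))
  intro a ha
  refine hA a ?_
  rw [← roots_ofRoots A, mem_roots (ofRoots_monic A).ne_zero]
  simpa using (mem_rootSet_of_ne (ofRoots_monic A).ne_zero).1 ha

open Classical in
/-- Rouché count of the zeros of `(g h)' q - g h q'`, compared with those of `g' h q`. -/
theorem countP_roots_wronskian {A B E : Multiset ℂ} (hEA : E.card < A.card) {K U : Set ℂ}
    (hK : Convex ℝ K) (hKU : K ⊆ U) (hU : IsOpen U) (hA : ∀ a ∈ A, a ∈ K)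
    (hfr : ∀ z ∈ frontier U, z ∉ A ∧ z ∉ B ∧ z ∉ E ∧
      ‖(B.map fun b => 1 / (z - b)).sum - (E.map fun b => 1 / (z - b)).sum‖ <
        ‖(A.map fun a => 1 / (z - a)).sum‖) :
    derivative (ofRoots A * ofRoots B) * ofRoots E -
        ofRoots A * ofRoots B * derivative (ofRoots E) ≠ 0 ∧
    (derivative (ofRoots A * ofRoots B) * ofRoots E -
        ofRoots A * ofRoots B * derivative (ofRoots E)).roots.countP (· ∈ U) =
      (A.card - 1) + B.countP (· ∈ U) + E.countP (· ∈ U) := by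
  set g := ofRoots A with hg
  set h := ofRoots B with hh
  set q := ofRoots E with hq
  have gm : g.Monic := ofRoots_monic A
  have hm : h.Monic := ofRoots_monic B
  have qm : q.Monic := ofRoots_monic E
  have gd : g.natDegree = A.card := natDegree_ofRoots A
  have hd : h.natDegree = B.card := natDegree_ofRoots B
  have qd : q.natDegree = E.card := natDegree_ofRoots E
  set d := A.card + B.card + E.card - 1 with hdd
  set F := derivative g * (h * q) with hF
  set G := derivative h * (g * q) - derivative q * (g * h) with hG
  have hFG : derivative (g * h) * q - g * h * derivative q = F + G := by
    rw [derivative_mul]; ring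
  have e1 : g.natDegree + (h * q).natDegree - 1 = d := by
    rw [hm.natDegree_mul qm]; omega
  have e2 : h.natDegree + (g * q).natDegree - 1 = d := by
    rw [gm.natDegree_mul qm]; omega
  have e3 : q.natDegree + (g * h).natDegree - 1 = d := by
    rw [gm.natDegree_mul hm]; omega
  have hFd : F.natDegree ≤ d := e1 ▸ natDegree_derivative_mul_le g (h * q)
  have hGd : G.natDegree ≤ d := by
    refine (natDegree_sub_le _ _).trans (max_le ?_ ?_)
    · exact e2 ▸ natDegree_derivative_mul_le h (g * q)
    · exact e3 ▸ natDegree_derivative_mul_le q (g * h)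
  have cF : F.coeff d = (A.card : ℂ) := by
    rw [← e1, coeff_derivative_mul gm (hm.mul qm), gd]
  have cG : G.coeff d = (B.card : ℂ) - E.card := by
    have c2 := coeff_derivative_mul hm (gm.mul qm)
    have c3 := coeff_derivative_mul qm (gm.mul hm)
    rw [e2, hd] at c2
    rw [e3, qd] at c3
    rw [hG, coeff_sub, c2, c3]
  -- The top coefficient |A| + t(|B| - |E|) stays positive because |E| < |A|, so no root escapes to
  -- infinity.
  have hlead : ∀ t ∈ Set.Icc (0 : ℝ) 1, F.coeff d + t * G.coeff d ≠ 0 := by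
    intro t ht
    rw [cF, cG]
    have : (0 : ℝ) < A.card + t * (B.card - E.card) := by
      have h1 : (E.card : ℝ) + 1 ≤ A.card := by exact_mod_cast hEA
      have h2 : 0 ≤ t * (B.card : ℝ) := mul_nonneg ht.1 (Nat.cast_nonneg _)
      have h3 : t * (E.card : ℝ) ≤ E.card := mul_le_of_le_one_left (Nat.cast_nonneg _) ht.2
      linarith
    exact_mod_cast this.ne'
  have hF0 : F ≠ 0 := fun h0 => hlead 0 (by simp) (by simp [h0])
  have hFG0 : F + G ≠ 0 := fun h0 => hlead 1 (by simp) (by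
    have := congrArg (fun p => p.coeff d) h0
    simpa using this)
  have hcount := countP_roots_add_eq hFd hGd hlead hU (by
    intro t ht z hz
    obtain ⟨hzA, hzB, hzE, hlt⟩ := hfr z hz
    set SA := (A.map fun a => 1 / (z - a)).sum
    set SB := (B.map fun a => 1 / (z - a)).sum
    set SE := (E.map fun a => 1 / (z - a)).sum
    have hv : F.eval z + t * G.eval z =
        g.eval z * h.eval z * q.eval z * (SA + t * (SB - SE)) := by
      simp only [hF, hG, eval_mul, eval_sub, hg, hh, hq, eval_derivative_ofRoots hzA,
        eval_derivative_ofRoots hzB, eval_derivative_ofRoots hzE]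
      ring
    rw [hv]
    refine mul_ne_zero (mul_ne_zero (mul_ne_zero (eval_ofRoots_ne_zero hzA)
      (eval_ofRoots_ne_zero hzB)) (eval_ofRoots_ne_zero hzE)) fun h0 => ?_
    have h1 : ‖SA‖ = ‖(t : ℂ) * (SB - SE)‖ := by
      rw [eq_neg_of_add_eq_zero_left h0, norm_neg]
    rw [norm_mul, Complex.norm_real, Real.norm_of_nonneg ht.1] at h1
    have h2 : t * ‖SB - SE‖ ≤ ‖SB - SE‖ := mul_le_of_le_one_left (norm_nonneg _) ht.2
    linarith)
  have hroots : F.roots = (derivative g).roots + (B + E) := by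
    rw [hF, roots_mul hF0, roots_mul (hm.mul qm).ne_zero, hh, hq, roots_ofRoots, roots_ofRoots]
  have hg' : (derivative g).roots.countP (· ∈ U) = A.card - 1 := by
    rw [Multiset.countP_eq_card.2 fun z hz => hKU (mem_of_mem_roots_derivative hK hA hz),
      ← (IsAlgClosed.splits (derivative g)).natDegree_eq_card_roots, natDegree_derivative, gd]
  rw [hFG]
  refine ⟨hFG0, ?_⟩
  rw [hcount, hroots, Multiset.countP_add, Multiset.countP_add, hg', add_assoc]

/-! ### From the numerator to critical points -/

/-- A pole of order `e` of a rational function is a pole of order more than `e` of its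
derivative. -/
theorem roots_denom_le_roots_denom_ratDeriv (f : RatFunc ℂ)
    (hN : derivative f.num * f.denom - f.num * derivative f.denom ≠ 0)
    (hmul : (ratDeriv f).num * f.denom ^ 2 =
      (derivative f.num * f.denom - f.num * derivative f.denom) * (ratDeriv f).denom) :
    f.denom.roots ≤ (ratDeriv f).denom.roots := by
  classical
  rw [Multiset.le_iff_count]
  intro b
  rw [count_roots, count_roots]
  have hQ := f.denom_ne_zero
  have hD := (ratDeriv f).denom_ne_zero
  have hM : (ratDeriv f).num ≠ 0 := fun h => mul_ne_zero hN hD (by rw [← hmul, h, zero_mul])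
  set N := derivative f.num * f.denom - f.num * derivative f.denom with hNdef
  set e := f.denom.rootMultiplicity b with he
  rcases Nat.eq_zero_or_pos e with h0 | hpos
  · rw [h0]; exact Nat.zero_le _
  have hb : f.denom.IsRoot b := (rootMultiplicity_pos hQ).1 hpos
  have hPb : ¬ f.num.IsRoot b := fun h => by
    obtain ⟨u, v, huv⟩ := f.isCoprime_num_denom
    have := congrArg (eval b) huv
    simp [h.eq_zero, hb.eq_zero] at this
  have hP : f.num ≠ 0 := fun h => hPb (by simp [h])
  have hQ' : derivative f.denom ≠ 0 := fun h => by
    have := derivative_eq_zero.1 h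
    obtain ⟨c, hc⟩ := natDegree_eq_zero.1 this
    rw [← hc] at hb hQ
    simp at hb hQ
    exact hQ hb
  have hlt : N.rootMultiplicity b < e := by
    by_contra! hle
    have h1 : (X - C b) ^ e ∣ N := (le_rootMultiplicity_iff hN).1 hle
    have h2 : (X - C b) ^ e ∣ derivative f.num * f.denom :=
      (pow_rootMultiplicity_dvd f.denom b).mul_left _
    have h3 : (X - C b) ^ e ∣ f.num * derivative f.denom := by
      have := dvd_sub h2 h1
      rwa [hNdef, sub_sub_cancel] at this
    have h4 := (le_rootMultiplicity_iff (mul_ne_zero hP hQ')).2 h3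
    rw [rootMultiplicity_mul (mul_ne_zero hP hQ'), rootMultiplicity_eq_zero hPb,
      derivative_rootMultiplicity_of_root hb] at h4
    omega
  have := congrArg (rootMultiplicity b) hmul
  rw [rootMultiplicity_mul (mul_ne_zero hM (pow_ne_zero 2 hQ)),
    rootMultiplicity_mul (mul_ne_zero hN hD), pow_two, rootMultiplicity_mul (mul_ne_zero hQ hQ)]
    at this
  omega

open Classical in
/-- If the numerator of `f'` over `f.denom ^ 2` has at least `j` zeros in `U` more than `f` has
poles there, then `f` has at least `j` critical points in `U`. -/
theorem le_critCount (f : RatFunc ℂ) {U : Set ℂ} {j : ℕ}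
    (hN : derivative f.num * f.denom - f.num * derivative f.denom ≠ 0)
    (h : j + f.denom.roots.countP (· ∈ U) ≤
      (derivative f.num * f.denom - f.num * derivative f.denom).roots.countP (· ∈ U)) :
    j ≤ critCount f U := by
  have hQ := f.denom_ne_zero
  have hD := (ratDeriv f).denom_ne_zero
  have hmul : (ratDeriv f).num * f.denom ^ 2 =
      (derivative f.num * f.denom - f.num * derivative f.denom) * (ratDeriv f).denom :=
    (RatFunc.num_mul_eq_mul_denom_iff (pow_ne_zero 2 hQ)).2 rfl
  have hM : (ratDeriv f).num ≠ 0 := fun h => mul_ne_zero hN hD (by rw [← hmul, h, zero_mul])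
  have hle := Multiset.countP_le_of_le (· ∈ U) (roots_denom_le_roots_denom_ratDeriv f hN hmul)
  have hr := congrArg (fun p => p.roots.countP (· ∈ U)) hmul
  rw [roots_mul (mul_ne_zero hM (pow_ne_zero 2 hQ)), roots_mul (mul_ne_zero hN hD), pow_two,
    roots_mul (mul_ne_zero hQ hQ)] at hr
  simp only [Multiset.countP_add] at hr
  rw [critCount, zeroCount]
  -- Every pole of f in U is cancelled at most once: crit + 2·poles = (zeros of the numerator) +
  -- (poles of f'), and f' has at least as many poles in U as f.
  omega

/-! ### Assembly and the explicit conditions -/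

/-- The approximate Gauss-Lucas property from a lower bound `L` for the Cauchy kernels of `K` on
the level sets of the distance to `K`. -/
theorem RAGL_of_re_cauchy_ge {K : Set ℂ} (hKc : Convex ℝ K) {n k : ℕ}
    {ε L : ℝ} (hε : 0 < ε) (hL0 : 0 ≤ L)
    (hL : ∀ δ, ε / 2 ≤ δ → δ < ε → ∀ z, Metric.infDist z K = δ →
      ∃ u : ℂ, ‖u‖ ≤ 1 ∧ ∀ a ∈ K, L ≤ (u * (1 / (z - a))).re)
    (hnk : n - k < k) (hcond : ((n - k : ℕ) : ℝ) * (8 * (n - k : ℕ) / ε) < k * L) :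
    RAGL K n k ε := by
  classical
  intro f hf hn hk
  set m := n - k with hm
  set A := f.num.roots.filter (· ∈ K) with hA
  set B := f.num.roots.filter (fun z => ¬ z ∈ K) with hB
  set E := f.denom.roots with hE
  have hAB : A + B = f.num.roots := Multiset.filter_add_not _ _
  have hkA : k ≤ A.card := by
    rw [hA, ← Multiset.countP_eq_card_filter]
    simpa only [zeroCount] using hk
  have hcard : A.card + B.card + E.card = n := by
    rw [← Multiset.card_add, hAB, ← hn]
    simp [zeroCount, poleCount, hE]
  have hBE : (B + E).card ≤ m := by rw [Multiset.card_add]; omega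
  obtain ⟨δ, hδ1, hδ2, hδ⟩ := exists_level_far hε
    ((B + E).map fun b => Metric.infDist b K).toFinset
    ((Multiset.toFinset_card_le _).trans ((Multiset.card_map _ _).trans_le hBE))
  have hδ0 : 0 < δ := (half_pos hε).trans_le hδ1
  set U := Metric.thickening δ K with hU
  have hfr : ∀ z ∈ frontier U, z ∉ A ∧ z ∉ B ∧ z ∉ E ∧
      ‖(B.map fun b => 1 / (z - b)).sum - (E.map fun b => 1 / (z - b)).sum‖ <
        ‖(A.map fun a => 1 / (z - a)).sum‖ := by
    intro z hz
    have hzδ : Metric.infDist z K = δ := by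
      have := Metric.frontier_thickening_subset K hz
      rw [Metric.infDist, this, ENNReal.toReal_ofReal hδ0.le]
    have hfar : ∀ b ∈ B + E, 0 < ε / (8 * m) ∧ ε / (8 * m) ≤ ‖z - b‖ := by
      intro b hb
      have hm0 : (0 : ℝ) < m := by
        have := Multiset.card_pos_iff_exists_mem.2 ⟨b, hb⟩
        exact_mod_cast this.trans_le hBE
      refine ⟨by positivity, (hδ (Metric.infDist b K) ?_).trans ?_⟩
      · exact Multiset.mem_toFinset.2 (Multiset.mem_map_of_mem _ hb)
      · rw [← hzδ, ← dist_eq_norm, ← Real.dist_eq]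
        simpa using (Metric.lipschitz_infDist_pt K).dist_le_mul z b
    have hne : ∀ b ∈ B + E, z ≠ b := fun b hb h => by
      obtain ⟨h1, h2⟩ := hfar b hb
      rw [h, sub_self, norm_zero] at h2
      linarith
    refine ⟨fun h => ?_, fun h => hne z (Multiset.mem_add.2 (Or.inl h)) rfl,
      fun h => hne z (Multiset.mem_add.2 (Or.inr h)) rfl, ?_⟩
    · have := Metric.infDist_zero_of_mem (Multiset.mem_filter.1 h).2
      linarith
    have hker : ∀ b ∈ B + E, ‖1 / (z - b)‖ ≤ 8 * m / ε := fun b hb => by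
      obtain ⟨h1, h2⟩ := hfar b hb
      rw [norm_div, norm_one]
      calc 1 / ‖z - b‖ ≤ 1 / (ε / (8 * m)) := one_div_le_one_div_of_le h1 h2
        _ = 8 * m / ε := one_div_div _ _
    obtain ⟨u, hu, hua⟩ := hL δ hδ1 hδ2 z hzδ
    calc _ ≤ ‖(B.map fun b => 1 / (z - b)).sum‖ + ‖(E.map fun b => 1 / (z - b)).sum‖ :=
          norm_sub_le _ _
      _ ≤ B.card * (8 * m / ε) + E.card * (8 * m / ε) := add_le_add
          (norm_sum_map_le fun b hb => hker b (Multiset.mem_add.2 (Or.inl hb)))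
          (norm_sum_map_le fun b hb => hker b (Multiset.mem_add.2 (Or.inr hb)))
      _ = ((B + E).card : ℝ) * (8 * m / ε) := by rw [Multiset.card_add]; push_cast; ring
      _ ≤ m * (8 * m / ε) := by gcongr
      _ < k * L := hcond
      _ ≤ A.card * L := by gcongr
      _ ≤ _ := le_norm_sum_map hu fun a ha => hua a (Multiset.mem_filter.1 ha).2
  obtain ⟨hW0, hW⟩ := countP_roots_wronskian (A := A) (B := B) (E := E) (by omega) hKc
    (Metric.self_subset_thickening hδ0 K) Metric.isOpen_thickening
    (fun a ha => (Multiset.mem_filter.1 ha).2) hfr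
  have hnum : f.num = C f.num.leadingCoeff * (ofRoots A * ofRoots B) := by
    conv_lhs => rw [(IsAlgClosed.splits f.num).eq_prod_roots, ← hAB]
    simp [ofRoots]
  have hden : f.denom = ofRoots E := by
    conv_lhs => rw [(IsAlgClosed.splits f.denom).eq_prod_roots, f.monic_denom.leadingCoeff]
    simp [ofRoots, hE]
  have hlc : f.num.leadingCoeff ≠ 0 := leadingCoeff_ne_zero.2 (RatFunc.num_ne_zero hf)
  have hN : derivative f.num * f.denom - f.num * derivative f.denom =
      C f.num.leadingCoeff * (derivative (ofRoots A * ofRoots B) * ofRoots E -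
        ofRoots A * ofRoots B * derivative (ofRoots E)) := by
    rw [← hden]
    generalize f.num.leadingCoeff = c at hnum
    rw [hnum, derivative_C_mul]
    ring
  have hcrit : k - 1 ≤ critCount f U := by
    refine le_critCount f ?_ ?_
    · rw [hN]; exact mul_ne_zero (C_ne_zero.2 hlc) hW0
    · rw [hN, roots_C_mul _ hlc, hW, hU, ← hE]
      omega
  refine hcrit.trans ?_
  simp only [critCount, zeroCount, Multiset.countP_eq_card_filter]
  exact Multiset.card_le_card (Multiset.monotone_filter_right _ fun z hz =>
    Metric.thickening_mono hδ2.le K hz)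

end RationalGaussLucas

theorem theorem1 (K : Set ℂ) (hKb : Bornology.IsBounded K) (hKc : Convex ℝ K)
    (n k : ℕ) (hk : 0 < k) (hkn : k ≤ n) (ε : ℝ) (hε : 0 < ε) :
    ((k = n ∨
        16 * (Metric.diam K + ε) ^ 2 / ε ^ 2 < (k : ℝ) / ((n : ℝ) - (k : ℝ)) ^ 2) →
      RationalGaussLucas.RAGL K n k ε) ∧
    (RationalGaussLucas.IsDisk K →
      (k = n ∨
        8 * (Metric.diam K + ε) / ε < (k : ℝ) / ((n : ℝ) - (k : ℝ)) ^ 2) →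
      RationalGaussLucas.RAGL K n k ε) := by
  classical
  rcases K.eq_empty_or_nonempty with rfl | hK
  · have : RationalGaussLucas.RAGL ∅ n k ε := fun f _ _ h => by
      simp [RationalGaussLucas.zeroCount] at h
      omega
    exact ⟨fun _ => this, fun _ _ => this⟩
  set s := Metric.diam K with hs
  have hs0 : 0 ≤ s := Metric.diam_nonneg
  have hkR : (0 : ℝ) < k := by exact_mod_cast hk
  have hmcast : ((n - k : ℕ) : ℝ) = (n : ℝ) - k := Nat.cast_sub hkn
  have clear_div : ∀ c : ℝ, 0 ≤ c →
      (k = n ∨ c < (k : ℝ) / ((n : ℝ) - (k : ℝ)) ^ 2) → c * ((n - k : ℕ) : ℝ) ^ 2 < k := by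
    rintro c hc (h | h)
    · subst h; simpa using hkR
    · rw [← hmcast] at h
      rcases Nat.eq_zero_or_pos (n - k) with h0 | h0
      · rw [h0]; simpa using hkR
      · have : (0 : ℝ) < (n - k : ℕ) := by exact_mod_cast h0
        exact (lt_div_iff₀ (by positivity)).1 h
  -- Both constants are at least 1, so m² < k and hence m < k: fewer poles than zeros in K.
  have lt_of_one_le : ∀ c : ℝ, 1 ≤ c → c * ((n - k : ℕ) : ℝ) ^ 2 < k → n - k < k := by
    intro c hc h
    have h1 : ((n - k : ℕ) : ℝ) ^ 2 < k :=
      lt_of_le_of_lt (le_mul_of_one_le_left (by positivity) hc) h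
    have h2 : (n - k) ^ 2 < k := by exact_mod_cast h1
    exact (Nat.le_self_pow two_ne_zero _).trans_lt h2
  constructor
  · intro h
    have h1 := clear_div _ (by positivity) h
    -- Worst case of δ/(s + δ)² on [ε/2, ε), bounding numerator and denominator separately; the ε/2
    -- turns 8 into 16.
    refine RationalGaussLucas.RAGL_of_re_cauchy_ge (L := ε / 2 / (s + ε) ^ 2) hKc hε
      (by positivity) (fun δ hδ1 hδ2 z hz => ?_) (lt_of_one_le _ ?_ h1) ?_
    · have hδ0 : 0 < δ := (half_pos hε).trans_le hδ1
      obtain ⟨u, hu, hua⟩ := RationalGaussLucas.exists_re_cauchy_ge hKb hKc hK hδ0 hz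
      refine ⟨u, hu, fun a ha => le_trans ?_ (hua a ha)⟩
      gcongr
    · rw [le_div_iff₀ (by positivity)]
      nlinarith
    · calc ((n - k : ℕ) : ℝ) * (8 * (n - k : ℕ) / ε)
          = (16 * (s + ε) ^ 2 / ε ^ 2 * ((n - k : ℕ) : ℝ) ^ 2) * (ε / 2 / (s + ε) ^ 2) := by
            field_simp; ring
        _ < k * (ε / 2 / (s + ε) ^ 2) := by gcongr
  · intro hd h
    have h1 := clear_div _ (by positivity) h
    -- The disk bound 1/(s + δ) has no δ in the numerator, so no factor 2 is lost.
    refine RationalGaussLucas.RAGL_of_re_cauchy_ge (L := 1 / (s + ε)) hKc hε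
      (by positivity) (fun δ hδ1 hδ2 z hz => ?_) (lt_of_one_le _ ?_ h1) ?_
    · have hδ0 : 0 < δ := (half_pos hε).trans_le hδ1
      obtain ⟨u, hu, hua⟩ := hd.exists_re_cauchy_ge hδ0 hz
      refine ⟨u, hu, fun a ha => le_trans ?_ (hua a ha)⟩
      gcongr
    · rw [le_div_iff₀ hε]
      nlinarith
    · calc ((n - k : ℕ) : ℝ) * (8 * (n - k : ℕ) / ε)
          = (8 * (s + ε) / ε * ((n - k : ℕ) : ℝ) ^ 2) * (1 / (s + ε)) := by field_simp
        _ < k * (1 / (s + ε)) := by gcongr
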